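/- Let $K$ be a finite simplicial complex embedded in $\mathbb R^{q+1}$ ($q\ge 0$), with arbitrarily oriented $q$-simplices ("edges") and with all $(q+1)$-simplices ("facets") oriented coherently with a fixed orientation of $\mathbb R^{q+1}$. A \emph{void} is a connected component of $\mathbb R^{q+1}\setminus|K|$ (the unbounded one included). Every oriented edge $e$ has one facet or void $\tau$ on its positive side and one, $\eta$, on its negative side, and we write $e=(\eta\rightharpoonup\tau)$; here a facet is on the positive (negative) side of $e$ iff $e$ occurs in its boundary with coefficient $+1$ ($-1$), and the sides of voids are fixed by the same convention. Let $R$ be $\mathbb Z$ (or any ordered commutative ring, e.g. $\mathbb R$); chains have coefficients in $R$. Let $c_e>0$ and $a_\tau\ge 0$ be weights of the edges and of the facets, $z\in Z_q(K;R)$ a $q$-cycle, $\mathcal S,\mathcal T$ finite sets of voids, and $\gamma_\nu\in R$. Consider the directed dual linear program, with variables $\pi$ on facets and voids, $\pi^{\pm}$ on facets, and $\vec x$ on both orientations $(\eta\rightharpoonup\tau)$, $(\tau\rightharpoonup\eta)$ of every edge: $$\min\ \sum_{\tau} a_\tau\pi^+_\tau+\sum_\tau a_\tau\pi^-_\tau+\sum_{\nu\in\mathcal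 T}\gamma_\nu\pi(\nu)-\sum_{\nu\in\mathcal S}\gamma_\nu\pi(\nu)+\sum_{e=(\eta\rightharpoonup\tau)}c_e\big(\vec x(\eta\rightharpoonup\tau)+\vec x(\tau\rightharpoonup\eta)\big)$$ subject to, for every edge $e=(\eta\rightharpoonup\tau)$, $$\pi(\eta)-\pi(\tau)+\vec x(\eta\rightharpoonup\tau)\ge -z(e),\qquad \pi(\tau)-\pi(\eta)+\vec x(\tau\rightharpoonup\eta)\ge z(e),$$ and $\vec x\ge 0$, $\pi^{\pm}\ge 0$, $\pi=\pi^+-\pi^-$ on facets, and $\pi(\nu)=0$ for every void $\nu$. All variables take values in $R$. Let $(\pi_\star,\vec x_\star)$ be an optimal solution. Then: (a) $\pi_\star(\nu)=0$ for every void $\nu$. (b) The $q$-chain $x_\star$ on $K$ defined by $x_\star(e)=\vec x_\star(\tau\rightharpoonup\eta)-\vec x_\star(\eta\rightharpoonup\tau)$ for $e=(\eta\rightharpoonup\tau)$ is a $q$-cycle homologous to $z$ on $K$ with $\partial_{q+1}\pi_\star=z-x_\star$, and it is minimal for the flat norm: for every $q$-cycle $x$ homologous to $z$ on $K$ and every $(q+1)$-chain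 $\pi$ with $\partial_{q+1}\pi=z-x$, $$\sum_e c_e|x_\star(e)|+\sum_\tau a_\tau|\pi_\star(\tau)|\ \le\ \sum_e c_e|x(e)|+\sum_\tau a_\tau|\pi(\tau)|.$$ In particular, if $a=0$, then $x_\star$ has the least cost $\sum_e c_e|x(e)|$ among all $q$-cycles $x$ homologous to $z$ on $K$ (optimal homologous cycle problem). -/

import Mathlib

noncomputable section

namespace FlatNorm

/-- Euclidean space of dimension `q + 1`. -/
abbrev Space (q : ℕ) : Type := EuclideanSpace ℝ (Fin (q + 1))

/-- The homogeneous determinant of `q + 2` points of `ℝ^(q+1)`: the determinant of the matrix with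
rows `(1, pᵢ)`. Its sign is the orientation of the simplex `[p₀, …, p_(q+1)]`. -/
def orientDet {q : ℕ} (p : Fin (q + 2) → Space q) : ℝ :=
  Matrix.det (Matrix.of fun i j : Fin (q + 2) =>
    (Fin.cons 1 (fun k => p i k) : Fin (q + 2) → ℝ) j)

/-- A finite simplicial complex `K` embedded in `ℝ^(q+1)`, with an orientation of each simplex.
The orientation of a simplex is recorded as a sign relative to the increasing order of its vertices
for an auxiliary linear order. It is arbitrary, except that the `(q+1)`-simplices are
all oriented like the ambient space, for one of its two orientations `ambient`. -/
structure OrientedComplex (q : ℕ) where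
  /-- the underlying geometric simplicial complex -/
  K : Geometry.SimplicialComplex ℝ (Space q)
  finite_faces : K.faces.Finite
  /-- the auxiliary order on vertices -/
  vord : LinearOrder (Space q)
  /-- the orientation of each simplex -/
  sgn : Finset (Space q) → ℤˣ
  /-- the orientation of the ambient space (`1` is the standard one) -/
  ambient : ℤˣ
  facet_oriented : ∀ s ∈ K.faces, ∀ h : s.card = q + 2,
    0 < (((ambient * sgn s : ℤˣ) : ℤ) : ℝ) * orientDet (@Finset.orderEmbOfFin _ vord s _ h)

namespace OrientedComplex

variable {q : ℕ} (O : OrientedComplex q)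

/-- The `k`-simplices of `K`. -/
def Simplex (k : ℕ) : Type := {s : Finset (Space q) // s ∈ O.K.faces ∧ s.card = k + 1}

/-- The `q`-simplices, called edge-simplices. -/
abbrev Edge : Type := O.Simplex q

/-- The `(q+1)`-simplices, called facet-simplices. -/
abbrev Facet : Type := O.Simplex (q + 1)

instance (k : ℕ) : Finite (O.Simplex k) :=
  (O.finite_faces.subset fun _ h => h.1 :
    {s : Finset (Space q) | s ∈ O.K.faces ∧ s.card = k + 1}.Finite).to_subtype

instance (k : ℕ) : Fintype (O.Simplex k) := Fintype.ofFinite _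

open Classical in
/-- The incidence number `[s : t]` of a `(k+1)`-simplex and a `k`-simplex: it is `0` unless `t` is
a face of `s`, and `sgn s * sgn t * (-1)^i` if `t` arises from `s` by removing its `i`-th vertex,
i.e. the vertex of `s` below which there are exactly `i` other vertices of `s`. -/
def incidence {k : ℕ} (s : O.Simplex (k + 1)) (t : O.Simplex k) : ℤ :=
  if t.1 ⊆ s.1 then
    ((O.sgn s.1 * O.sgn t.1 : ℤˣ) : ℤ) *
      (-1) ^ (s.1.filter fun u => ∃ v ∈ s.1, v ∉ t.1 ∧ O.vord.lt u v).card
  else 0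

/-- The `k`-chains of `K` with coefficients in `R`. -/
abbrev Chain (R : Type*) (k : ℕ) : Type _ := O.Simplex k → R

/-- The boundary operator `∂ : C_(k+1)(K; R) → C_k(K; R)`. -/
def boundary {R : Type*} [CommRing R] (k : ℕ) (y : O.Chain R (k + 1)) : O.Chain R k :=
  fun t => ∑ s, (O.incidence s t : R) * y s

/-- The `k`-cycles of `K` (every `0`-chain is a `0`-cycle). -/
def IsCycle {R : Type*} [CommRing R] : (k : ℕ) → O.Chain R k → Prop
  | 0, _ => True
  | k + 1, x => O.boundary k x = 0

/-- Two `k`-chains are homologous on `K` if they differ by a boundary. -/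
def Homologous {R : Type*} [CommRing R] {k : ℕ} (z x : O.Chain R k) : Prop :=
  ∃ p : O.Chain R (k + 1), O.boundary k p = z - x

/-- The voids of `K`: the connected components of the complement of `|K|` in `ℝ^(q+1)`,
including the unbounded (outer) one. -/
def Void : Type :=
  {C : Set (Space q) // ∃ x ∈ (O.K.space)ᶜ, C = connectedComponentIn (O.K.space)ᶜ x}

/-- The `(q+1)`-dimensional cells of the voidless complex `K̄`: facet-simplices and voids. -/
abbrev Cell : Type := O.Facet ⊕ O.Void

/-- The side of the (hyperplane of the) oriented edge-simplex `e` on which the point `w` lies: this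
is positive iff `[w, e]` is oriented like the ambient space, so that `e` occurs with coefficient
`1` in the boundary of the positively oriented simplex `[w, e]`. -/
def side (e : O.Edge) (w : Space q) : ℝ :=
  (((O.ambient * O.sgn e.1 : ℤˣ) : ℤ) : ℝ) *
    orientDet (Fin.cons w (@Finset.orderEmbOfFin _ O.vord e.1 _ e.2.2))

/-- The void `ν` touches `e` from the side with sign `ε`: a short segment that leaves `e` at its
barycentre towards that side runs inside `ν`. -/
def VoidTouches (ε : ℤˣ) (e : O.Edge) (ν : O.Void) : Prop :=
  ∃ w : Space q, 0 < ((ε : ℤ) : ℝ) * O.side e w ∧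
    openSegment ℝ (e.1.centroid ℝ id) w ⊆ ν.1

/-- The cell `c` of `K̄` is a coface of `e` with incidence number `ε = ±1`, i.e. it lies on the
side of `e` with sign `ε`. -/
def IsCoface (ε : ℤˣ) (e : O.Edge) : O.Cell → Prop
  | Sum.inl τ => O.incidence τ e = (ε : ℤ)
  | Sum.inr ν => O.VoidTouches ε e ν

/-- `e = (η ⇀ τ)`: the oriented edge-simplex `e` points from the cell `η` to the cell `τ`, i.e. the
coboundary of `e` in `K̄` is `τ - η`. -/
def Dart (e : O.Edge) (η τ : O.Cell) : Prop :=
  O.IsCoface (-1) e η ∧ O.IsCoface 1 e τ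

section LP

variable {R : Type*} [CommRing R] [LinearOrder R] [IsStrictOrderedRing R]

/-- The data of the directed linear program. -/
structure DirData (R : Type*) where
  /-- the length-weights (capacities) of the edge-simplices -/
  c : O.Edge → R
  /-- the area-weights of the facet-simplices -/
  a : O.Facet → R
  /-- the input `q`-chain -/
  z : O.Chain R q
  /-- the source voids -/
  S : Finset O.Void
  /-- the sink voids -/
  T : Finset O.Void
  /-- the flow values at the source and sink voids -/
  γ : O.Void → R

/-- The variables of the directed dual linear program. -/
structure DirVar (R : Type*) where
  /-- the potential `π`, on facet-simplices and voids -/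
  pot : O.Cell → R
  /-- the positive component `π⁺` -/
  potPos : O.Facet → R
  /-- the negative component `π⁻` -/
  potNeg : O.Facet → R
  /-- the value of `x⃗` on the natural orientation `(η ⇀ τ)` of each edge-simplex -/
  xNat : O.Edge → R
  /-- the value of `x⃗` on the opposite orientation `(τ ⇀ η)` of each edge-simplex -/
  xOpp : O.Edge → R

variable {O}

/-- The objective function of the directed dual linear program. -/
def DirVar.cost (v : O.DirVar R) (d : O.DirData R) : R :=
  ∑ τ, d.a τ * v.potPos τ + ∑ τ, d.a τ * v.potNeg τ
    + ∑ ν ∈ d.T, d.γ ν * v.pot (Sum.inr ν) - ∑ ν ∈ d.S, d.γ ν * v.pot (Sum.inr ν)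
    + ∑ e, d.c e * (v.xNat e + v.xOpp e)

/-- The constraints of the directed dual linear program. -/
structure DirVar.Feasible (v : O.DirVar R) (d : O.DirData R) : Prop where
  nat : ∀ e η τ, O.Dart e η τ → v.pot η - v.pot τ + v.xNat e ≥ -d.z e
  opp : ∀ e η τ, O.Dart e η τ → v.pot τ - v.pot η + v.xOpp e ≥ d.z e
  xNat_nonneg : ∀ e, 0 ≤ v.xNat e
  xOpp_nonneg : ∀ e, 0 ≤ v.xOpp e
  void : ∀ ν, v.pot (Sum.inr ν) = 0
  potPos_nonneg : ∀ τ, 0 ≤ v.potPos τ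
  potNeg_nonneg : ∀ τ, 0 ≤ v.potNeg τ
  pot_eq : ∀ τ, v.pot (Sum.inl τ) = v.potPos τ - v.potNeg τ

/-- Optimal solutions of the directed dual linear program. -/
def DirVar.Optimal (v : O.DirVar R) (d : O.DirData R) : Prop :=
  v.Feasible d ∧ ∀ w : O.DirVar R, w.Feasible d → v.cost d ≤ w.cost d

/-- The potential as a `(q+1)`-chain of `K`. -/
def DirVar.chain (v : O.DirVar R) : O.Chain R (q + 1) := fun τ => v.pot (Sum.inl τ)

/-- The `q`-chain `x(η | τ) = x⃗(τ ⇀ η) - x⃗(η ⇀ τ)`. -/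
def DirVar.x (v : O.DirVar R) : O.Chain R q := fun e => v.xOpp e - v.xNat e

/-- The weighted `ℓ¹` cost `∑ wₛ |yₛ|` of a chain. -/
def weight {k : ℕ} (w : O.Simplex k → R) (y : O.Chain R k) : R := ∑ s, w s * |y s|

/-- `x` is a minimal `q`-cycle homologous to `z` on `K`, through the `(q+1)`-chain `p`, for the
(simplicial) flat norm: `x` is a cycle, `∂p = z - x`, and the total cost `c(|x|) + a(|p|)` is least
among all `q`-cycles homologous to `z` and all `(q+1)`-chains that realize the homology. -/
def IsMinimalCycle (d : O.DirData R) (x : O.Chain R q) (p : O.Chain R (q + 1)) : Prop :=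
  O.IsCycle q x ∧ O.Homologous d.z x ∧ O.boundary q p = d.z - x ∧
    ∀ (x' : O.Chain R q) (p' : O.Chain R (q + 1)), O.IsCycle q x' → O.boundary q p' = d.z - x' →
      weight d.c x + weight d.a p ≤ weight d.c x' + weight d.a p'

end LP

end OrientedComplex

end FlatNorm

end

namespace FlatNorm

/-! No linear programming duality is involved; the point is that the program is the flat norm
problem in disguise. Geometry: near its barycentre, each side of an edge `e` is either filled by
exactly one facet (`facet_unique`), and then no void touches `e` there (`not_voidTouches`), or is
free of `|K|`, and then some void does (`exists_voidTouches`). As potentials vanish on voids,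
`(∂π)(e) = π(τ) - π(η)` for `e = (η ⇀ τ)` (`boundary_eq_of_dart`). Optimization: the constraints
therefore say that `xOpp` and `xNat` dominate the positive and negative parts of `z - ∂π`. Since `c
> 0`, an optimum attains both bounds, so `x = z - ∂π` (`DirVar.Optimal.x_eq`), which is a cycle by
`∂∂ = 0`. Conversely every chain `p` yields a feasible point whose cost is the flat norm cost of `(z
- ∂p, p)` (`DirVar.cost_ofChain`), and comparing costs gives minimality. -/

/-! ### Orientation determinants and barycentres. -/

/-- Moving row `i` to the front is a cycle on the first `i + 1` rows, of sign `(-1)^i`. -/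
theorem orientDet_cons_removeNth {q : ℕ} (p : Fin (q + 2) → Space q) (i : Fin (q + 2)) :
    orientDet (Fin.cons (p i) (i.removeNth p)) = (-1) ^ (i : ℕ) * orientDet p := by
  rw [Fin.cons_removeNth_eq_comp_cycleRange_symm]
  have h := Matrix.det_permute i.cycleRange.symm (Matrix.of fun i j : Fin (q + 2) =>
    (Fin.cons 1 (fun k => p i k) : Fin (q + 2) → ℝ) j)
  rw [show Equiv.Perm.sign (Equiv.symm i.cycleRange) = Equiv.Perm.sign i.cycleRange from
    Equiv.Perm.sign_inv _, Fin.sign_cycleRange] at h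
  simpa [orientDet, Matrix.submatrix, Function.comp_def] using h

/-- A linear relation among the rows `(1, pᵢ)` is an affine dependence: the column of ones makes the
coefficients sum to zero. -/
theorem orientDet_ne_zero {q : ℕ} {p : Fin (q + 2) → Space q} (hp : AffineIndependent ℝ p) :
    orientDet p ≠ 0 := by
  intro h
  obtain ⟨v, hv, hv0⟩ := Matrix.exists_vecMul_eq_zero_iff.2 h
  have h1 : ∑ i, v i = 0 := by
    simpa [Matrix.vecMul, dotProduct] using congrFun hv0 0
  have h2 : ∑ i, v i • p i = 0 := by
    ext k
    simpa [Matrix.vecMul, dotProduct] using congrFun hv0 k.succ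
  exact hv (funext fun i => affineIndependent_iff.1 hp Finset.univ v h1 h2 i (Finset.mem_univ i))

theorem orientDet_cons_eq_zero {q : ℕ} (f : Fin (q + 1) → Space q) (i : Fin (q + 1)) :
    orientDet (Fin.cons (f i) f : Fin (q + 2) → Space q) = 0 :=
  Matrix.det_zero_of_row_eq (Fin.succ_ne_zero i).symm (by ext j; simp)

theorem exists_affineMap_orientDet_cons {q : ℕ} (f : Fin (q + 1) → Space q) :
    ∃ φ : Space q →ᵃ[ℝ] ℝ, ∀ w, φ w = orientDet (Fin.cons w f : Fin (q + 2) → Space q) := by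
  let A : Fin (q + 2) → ℝ := fun j => (-1) ^ (j : ℕ) *
    ((Matrix.of fun i j : Fin (q + 2) =>
      (Fin.cons 1 (fun k => (Fin.cons 0 f : Fin (q + 2) → Space q) i k) :
        Fin (q + 2) → ℝ) j).submatrix Fin.succ j.succAbove).det
  let l : Space q →ₗ[ℝ] ℝ :=
    { toFun := fun w => ∑ k, w k * A k.succ
      map_add' := fun x y => by simp [add_mul, Finset.sum_add_distrib]
      map_smul' := fun c x => by simp [Finset.mul_sum, mul_assoc] }
  refine ⟨l.toAffineMap + AffineMap.const ℝ _ (A 0), fun w => ?_⟩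
  rw [orientDet, Matrix.det_succ_row_zero, Fin.sum_univ_succ]
  have hs : ∀ j : Fin (q + 2), ((Matrix.of fun i j : Fin (q + 2) =>
      (Fin.cons 1 (fun k => (Fin.cons w f : Fin (q + 2) → Space q) i k) :
        Fin (q + 2) → ℝ) j).submatrix Fin.succ j.succAbove) =
      ((Matrix.of fun i j : Fin (q + 2) =>
      (Fin.cons 1 (fun k => (Fin.cons 0 f : Fin (q + 2) → Space q) i k) :
        Fin (q + 2) → ℝ) j).submatrix Fin.succ j.succAbove) := by
    intro j; ext a b; simp
  simp only [hs]
  simp only [AffineMap.coe_add, Pi.add_apply, LinearMap.coe_toAffineMap, AffineMap.const_apply,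
    Matrix.of_apply, Fin.cons_zero, Fin.cons_succ, l, A, LinearMap.coe_mk, AddHom.coe_mk]
  rw [add_comm]
  congr 1
  · simp
  · exact Finset.sum_congr rfl fun k _ => by ring

theorem affineMap_sum {V : Type*} [AddCommGroup V] [Module ℝ V] {ι : Type*} (φ : V →ᵃ[ℝ] ℝ)
    (s : Finset ι) (m : ι → ℝ) (p : ι → V) (hm : ∑ y ∈ s, m y = 1) :
    φ (∑ y ∈ s, m y • p y) = ∑ y ∈ s, m y * φ (p y) := by
  rw [← s.affineCombination_eq_linear_combination p m hm, s.map_affineCombination p m hm φ,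
    s.affineCombination_eq_linear_combination _ m hm]
  simp

theorem centroid_eq_sum {V : Type*} [AddCommGroup V] [Module ℝ V] (s : Finset V)
    (hs : s.Nonempty) : s.centroid ℝ id = ∑ y ∈ s, (s.card : ℝ)⁻¹ • y := by
  rw [Finset.centroid_def, Finset.affineCombination_eq_linear_combination _ _ _
    (s.sum_centroidWeights_eq_one_of_nonempty ℝ hs)]
  simp

/-- The barycentre of an affinely independent set lies on no proper face. -/
theorem centroid_notMem_convexHull {V : Type*} [AddCommGroup V] [Module ℝ V] {s u : Finset V}
    (hs : AffineIndependent ℝ ((↑) : s → V)) (hne : s.Nonempty) (hu : u ⊂ s) :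
    s.centroid ℝ id ∉ convexHull ℝ (u : Set V) := by
  classical
  intro h
  obtain ⟨m, -, hm1, hm⟩ := Finset.mem_convexHull'.1 h
  obtain ⟨y, hys, hyu⟩ := Finset.exists_of_ssubset hu
  have hsub := hu.subset
  -- Difference of two barycentric representations of the centroid; it is nonzero at `y`, which is
  -- not in `u`.
  let w : V → ℝ := fun x => (s.card : ℝ)⁻¹ - if x ∈ u then m x else 0
  have hc : (s.card : ℝ) ≠ 0 := by exact_mod_cast hne.card_pos.ne'
  have h1 : ∑ x ∈ s, w x = 0 := by
    simp only [w, Finset.sum_sub_distrib, Finset.sum_ite_mem, Finset.inter_eq_right.2 hsub, hm1]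
    simp [hc]
  have h2 : ∑ x ∈ s, w x • x = 0 := by
    simp only [w, sub_smul, Finset.sum_sub_distrib, ite_smul, zero_smul, Finset.sum_ite_mem,
      Finset.inter_eq_right.2 hsub, hm]
    rw [centroid_eq_sum s hne, sub_self]
  have := affineIndependent_iff.1 hs Finset.univ (fun x => w x)
    (by rw [← h1]; exact Finset.sum_coe_sort s w)
    (by rw [← h2]; exact Finset.sum_coe_sort s (fun x => w x • x)) ⟨y, hys⟩ (Finset.mem_univ _)
  simp [w, hyu, hc] at this

namespace OrientedComplex

variable {q : ℕ} (O : OrientedComplex q)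

/-! ### Incidence numbers and the apex opposite a face. -/

theorem Simplex.nonempty {k : ℕ} (s : O.Simplex k) : s.1.Nonempty :=
  O.K.nonempty_of_mem_faces s.2.1

variable {O}

theorem incidence_of_apex {k : ℕ} {s : O.Simplex (k + 1)} {t : O.Simplex k} (h : t.1 ⊆ s.1)
    {w : Space q} (hw : w ∈ s.1) (hwt : w ∉ t.1) [DecidablePred fun u => O.vord.lt u w] :
    O.incidence s t = ((O.sgn s.1 * O.sgn t.1 : ℤˣ) : ℤ) *
      (-1) ^ (s.1.filter fun u => O.vord.lt u w).card := by
  classical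
  have hcard : (s.1 \ t.1).card = 1 := by
    rw [Finset.card_sdiff_of_subset h, s.2.2, t.2.2]; omega
  have huniq : ∀ v, v ∈ s.1 → v ∉ t.1 → v = w := fun v hv hvt =>
    Finset.card_le_one.1 hcard.le v (Finset.mem_sdiff.2 ⟨hv, hvt⟩) w
      (Finset.mem_sdiff.2 ⟨hw, hwt⟩)
  rw [incidence, if_pos h]
  congr 3
  ext u
  simp only [Finset.mem_filter, and_congr_right_iff]
  intro _
  constructor
  · rintro ⟨v, hv, hvt, hlt⟩
    rwa [← huniq v hv hvt]
  · exact fun hlt => ⟨w, hw, hwt, hlt⟩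

theorem exists_apex {k : ℕ} {s : O.Simplex (k + 1)} {t : O.Simplex k} (h : t.1 ⊆ s.1) :
    ∃ w ∈ s.1, w ∉ t.1 ∧ ∀ v ∈ s.1, v = w ∨ v ∈ t.1 := by
  classical
  have hcard : (s.1 \ t.1).card = 1 := by
    rw [Finset.card_sdiff_of_subset h, s.2.2, t.2.2]; omega
  obtain ⟨w, hw⟩ := Finset.card_eq_one.1 hcard
  have hw' := Finset.ext_iff.1 hw
  simp only [Finset.mem_sdiff, Finset.mem_singleton] at hw'
  refine ⟨w, ((hw' w).2 rfl).1, ((hw' w).2 rfl).2, fun v hv => ?_⟩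
  by_cases hvt : v ∈ t.1
  · exact Or.inr hvt
  · exact Or.inl ((hw' v).1 ⟨hv, hvt⟩)

theorem subset_of_incidence_ne_zero {k : ℕ} {s : O.Simplex (k + 1)} {t : O.Simplex k}
    (h : O.incidence s t ≠ 0) : t.1 ⊆ s.1 := by
  by_contra hn
  exact h (if_neg hn)

theorem incidence_eq_unit {k : ℕ} {s : O.Simplex (k + 1)} {t : O.Simplex k} (h : t.1 ⊆ s.1) :
    ∃ ε : ℤˣ, O.incidence s t = (ε : ℤ) := by
  classical
  obtain ⟨w, hw, hwt, -⟩ := exists_apex h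
  exact ⟨O.sgn s.1 * O.sgn t.1 * (-1) ^ (s.1.filter fun u => O.vord.lt u w).card,
    by rw [incidence_of_apex h hw hwt]; simp⟩

/-- The incidence number of a facet-simplex records the side on which its apex lies. -/
theorem side_apex {τ : O.Facet} {e : O.Edge} (h : e.1 ⊆ τ.1) {w : Space q} (hw : w ∈ τ.1)
    (hwe : w ∉ e.1) :
    ∃ D : ℝ, 0 < D ∧ O.side e w = (O.incidence τ e : ℝ) * D := by
  classical
  let := O.vord
  -- The factor `D` is the determinant of `τ` with its sign, positive by coherent orientation.
  refine ⟨_, O.facet_oriented τ.1 τ.2.1 τ.2.2, ?_⟩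
  set p := Finset.orderEmbOfFin τ.1 τ.2.2 with hp
  obtain ⟨i, hi⟩ : ∃ i, p i = w := by
    have : w ∈ Set.range p := by rw [hp, Finset.range_orderEmbOfFin]; exact hw
    exact this
  have hrem : (Finset.orderEmbOfFin e.1 e.2.2 : Fin (q + 1) → Space q) = i.removeNth p := by
    refine (Finset.orderEmbOfFin_unique e.2.2 (fun j => ?_) ?_).symm
    · obtain ⟨w', hw', hwe', hall⟩ := exists_apex h
      have hww : w' = w := by
        rcases hall w hw with h | h
        · exact h.symm
        · exact absurd h hwe
      have hmem : p (i.succAbove j) ∈ τ.1 := Finset.orderEmbOfFin_mem _ _ _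
      rcases hall _ hmem with h | h
      · exact absurd (p.injective (h.trans (hww.trans hi.symm))) (Fin.succAbove_ne i j)
      · exact h
    · exact p.strictMono.comp (Fin.strictMono_succAbove i)
  have hcard : (τ.1.filter fun u => u < w).card = i := by
    have : (τ.1.filter fun u => u < w) = (Finset.Iio i).map p.toEmbedding := by
      ext u
      simp only [Finset.mem_filter, Finset.mem_map, Finset.mem_Iio]
      constructor
      · rintro ⟨hu, hlt⟩
        have : u ∈ Set.range p := by rw [hp, Finset.range_orderEmbOfFin]; exact hu
        obtain ⟨j, rfl⟩ := this
        rw [← hi] at hlt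
        exact ⟨j, p.lt_iff_lt.1 hlt, rfl⟩
      · rintro ⟨j, hj, rfl⟩
        refine ⟨Finset.orderEmbOfFin_mem _ _ _, ?_⟩
        rw [← hi]; exact p.lt_iff_lt.2 hj
    rw [this, Finset.card_map, Fin.card_Iio]
  have hinc := incidence_of_apex h hw hwe
  have hdet := orientDet_cons_removeNth p i
  rw [hi, ← hrem] at hdet
  have hcard' : (τ.1.filter fun u => O.vord.lt u w).card = i := hcard
  rw [hinc, hcard', side]
  erw [hdet]
  -- `sgn τ` enters once through the incidence number and once through `D`, so it cancels.
  have hs : (((O.sgn τ.1 : ℤˣ) : ℤ) : ℝ) * (((O.sgn τ.1 : ℤˣ) : ℤ) : ℝ) = 1 := by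
    rcases Int.units_eq_one_or (O.sgn τ.1) with h | h <;> simp [h]
  push_cast
  linear_combination (-(((O.ambient : ℤˣ) : ℤ) : ℝ) * (((O.sgn e.1 : ℤˣ) : ℤ) : ℝ) *
    (-1) ^ (i : ℕ) * orientDet p) * hs

variable (O)

/-! ### The boundary of a boundary vanishes. -/

/-- If `r` is `t` with two more vertices `a < b`, only `r \ {a}` and `r \ {b}` contribute. Deleting
`a` first lowers the index of `b` by one, while deleting `b` first leaves that of `a` unchanged, so
the two terms have opposite signs. -/
theorem boundary_boundary_coeff {k : ℕ} (r : O.Simplex (k + 2)) (t : O.Simplex k) :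
    ∑ s : O.Simplex (k + 1), O.incidence r s * O.incidence s t = 0 := by
  classical
  let := O.vord
  by_cases htr : t.1 ⊆ r.1
  swap
  · refine Finset.sum_eq_zero fun s _ => ?_
    by_contra hne
    exact htr ((subset_of_incidence_ne_zero (right_ne_zero_of_mul hne)).trans
      (subset_of_incidence_ne_zero (left_ne_zero_of_mul hne)))
  have hcard : (r.1 \ t.1).card = 2 := by
    rw [Finset.card_sdiff_of_subset htr, r.2.2, t.2.2]; omega
  obtain ⟨a, b, hlt, hab⟩ : ∃ a b, a < b ∧ r.1 \ t.1 = {a, b} := by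
    obtain ⟨a, b, hne, hab⟩ := Finset.card_eq_two.1 hcard
    rcases lt_or_gt_of_ne hne with h | h
    · exact ⟨a, b, h, hab⟩
    · exact ⟨b, a, h, by rw [hab, Finset.pair_comm]⟩
  have hmem := Finset.ext_iff.1 hab
  simp only [Finset.mem_sdiff, Finset.mem_insert, Finset.mem_singleton] at hmem
  obtain ⟨har, hat⟩ := (hmem a).2 (Or.inl rfl)
  obtain ⟨hbr, hbt⟩ := (hmem b).2 (Or.inr rfl)
  have herase : ∀ v ∈ r.1, v ∉ t.1 → t.1 ⊆ r.1.erase v ∧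
      r.1.erase v ∈ O.K.faces ∧ (r.1.erase v).card = k + 1 + 1 := fun v hv hvt =>
    have hsub : t.1 ⊆ r.1.erase v := fun u hu =>
      Finset.mem_erase.2 ⟨fun h => hvt (h ▸ hu), htr hu⟩
    ⟨hsub, O.K.down_closed r.2.1 (Finset.erase_subset _ _) ((Simplex.nonempty O t).mono hsub),
      by rw [Finset.card_erase_of_mem hv, r.2.2]; omega⟩
  let sa : O.Simplex (k + 1) := ⟨r.1.erase a, (herase a har hat).2⟩
  let sb : O.Simplex (k + 1) := ⟨r.1.erase b, (herase b hbr hbt).2⟩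
  have hsab : sa ≠ sb := fun h => by
    have : b ∈ sa.1 := Finset.mem_erase.2 ⟨hlt.ne', hbr⟩
    rw [h] at this
    exact (Finset.notMem_erase b r.1) this
  rw [Finset.sum_eq_add sa sb hsab _ (by simp) (by simp)]
  · have h1 := incidence_of_apex (s := r) (t := sa) (Finset.erase_subset _ _) har
      (Finset.notMem_erase _ _)
    have h2 := incidence_of_apex (s := r) (t := sb) (Finset.erase_subset _ _) hbr
      (Finset.notMem_erase _ _)
    have h3 := incidence_of_apex (s := sa) (t := t) (herase a har hat).1
      (Finset.mem_erase.2 ⟨hlt.ne', hbr⟩) hbt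
    have h4 := incidence_of_apex (s := sb) (t := t) (herase b hbr hbt).1
      (Finset.mem_erase.2 ⟨hlt.ne, har⟩) hat
    have c4 : (sb.1.filter fun u => O.vord.lt u a) = r.1.filter fun u => O.vord.lt u a := by
      ext u
      simp only [sb, Finset.mem_filter, Finset.mem_erase]
      exact ⟨fun h => ⟨h.1.2, h.2⟩, fun h => ⟨⟨fun hub => lt_asymm hlt (hub ▸ h.2), h.1⟩, h.2⟩⟩
    have c3 : (r.1.filter fun u => O.vord.lt u b).card =
        (sa.1.filter fun u => O.vord.lt u b).card + 1 := by
      have : (sa.1.filter fun u => O.vord.lt u b) =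
          (r.1.filter fun u => O.vord.lt u b).erase a := by
        simp only [sa, Finset.filter_erase]
      rw [this, Finset.card_erase_add_one (Finset.mem_filter.2 ⟨har, hlt⟩)]
    rw [h1, h2, h3, h4, c4, c3]
    have hsq : ∀ u : ℤˣ, (u : ℤ) * u = 1 := fun u => by
      rcases Int.units_eq_one_or u with h | h <;> simp [h]
    have ha := hsq (O.sgn sa.1)
    have hb := hsq (O.sgn sb.1)
    push_cast
    rw [pow_succ]
    linear_combination ((O.sgn r.1 : ℤˣ) : ℤ) * ((O.sgn t.1 : ℤˣ) : ℤ) *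
      (-1) ^ (r.1.filter fun u => O.vord.lt u a).card *
      (-1) ^ (sa.1.filter fun u => O.vord.lt u b).card * (ha - hb)
  · rintro s - ⟨hsa, hsb⟩
    by_contra hne
    have hsr := subset_of_incidence_ne_zero (left_ne_zero_of_mul hne)
    have hts := subset_of_incidence_ne_zero (right_ne_zero_of_mul hne)
    obtain ⟨w, hwr, hws, -⟩ := exists_apex hsr
    have hs : s.1 = r.1.erase w := by
      refine Finset.eq_of_subset_of_card_le (fun u hu => Finset.mem_erase.2
        ⟨fun h => hws (h ▸ hu), hsr hu⟩) ?_
      rw [Finset.card_erase_of_mem hwr, r.2.2, s.2.2]; omega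
    rcases (hmem w).1 ⟨hwr, fun h => hws (hts h)⟩ with rfl | rfl
    · exact hsa (Subtype.ext hs)
    · exact hsb (Subtype.ext hs)

theorem boundary_boundary {R : Type*} [CommRing R] {k : ℕ} (y : O.Chain R (k + 2)) :
    O.boundary k (O.boundary (k + 1) y) = 0 := by
  funext t
  simp only [boundary, Finset.mul_sum, Pi.zero_apply]
  rw [Finset.sum_comm]
  refine Finset.sum_eq_zero fun r _ => ?_
  have := congrArg (Int.cast : ℤ → R) (O.boundary_boundary_coeff r t)
  push_cast at this
  calc _ = (∑ s, (O.incidence r s : R) * (O.incidence s t : R)) * y r := by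
        rw [Finset.sum_mul]; exact Finset.sum_congr rfl fun s _ => by ring
    _ = 0 := by rw [this, zero_mul]

theorem isCycle_boundary {R : Type*} [CommRing R] {k : ℕ} (y : O.Chain R (k + 1)) :
    O.IsCycle k (O.boundary k y) := by
  cases k with
  | zero => trivial
  | succ k => exact O.boundary_boundary y

theorem IsCycle.sub {R : Type*} [CommRing R] {k : ℕ} {x y : O.Chain R k} (hx : O.IsCycle k x)
    (hy : O.IsCycle k y) : O.IsCycle k (x - y) := by
  cases k with
  | zero => trivial
  | succ k =>
    have h : O.boundary k (x - y) = O.boundary k x - O.boundary k y := by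
      funext t
      simp [boundary, mul_sub]
    change O.boundary k (x - y) = 0
    rw [h, show O.boundary k x = 0 from hx, show O.boundary k y = 0 from hy, sub_zero]

open Filter Topology

/-! ### The side of an edge as an affine function. -/

theorem exists_affineMap_side (e : O.Edge) : ∃ φ : Space q →ᵃ[ℝ] ℝ, ∀ w, φ w = O.side e w := by
  obtain ⟨φ, hφ⟩ := exists_affineMap_orientDet_cons (@Finset.orderEmbOfFin _ O.vord e.1 _ e.2.2)
  exact ⟨(((O.ambient * O.sgn e.1 : ℤˣ) : ℤ) : ℝ) • φ, fun w => by
    rw [side, AffineMap.coe_smul, Pi.smul_apply, hφ, smul_eq_mul]⟩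

theorem side_sum (e : O.Edge) {ι : Type*} (s : Finset ι) (m : ι → ℝ) (p : ι → Space q)
    (hm : ∑ y ∈ s, m y = 1) :
    O.side e (∑ y ∈ s, m y • p y) = ∑ y ∈ s, m y * O.side e (p y) := by
  obtain ⟨φ, hφ⟩ := O.exists_affineMap_side e
  simp only [← hφ]
  exact affineMap_sum φ s m p hm

theorem side_eq_zero_of_mem (e : O.Edge) {w : Space q} (hw : w ∈ e.1) : O.side e w = 0 := by
  let := O.vord
  obtain ⟨i, rfl⟩ : w ∈ Set.range (Finset.orderEmbOfFin e.1 e.2.2) := by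
    rw [Finset.range_orderEmbOfFin]; exact hw
  exact mul_eq_zero_of_right _ (orientDet_cons_eq_zero _ i)

theorem side_eq_zero_of_mem_convexHull (e : O.Edge) {w : Space q}
    (hw : w ∈ convexHull ℝ (e.1 : Set (Space q))) : O.side e w = 0 := by
  obtain ⟨m, -, hm1, rfl⟩ := Finset.mem_convexHull'.1 hw
  rw [O.side_sum e _ _ _ hm1]
  exact Finset.sum_eq_zero fun y hy => by rw [O.side_eq_zero_of_mem e hy, mul_zero]

/-- The barycentre of a simplex. -/
noncomputable abbrev barycentre {k : ℕ} (e : O.Simplex k) : Space q := e.1.centroid ℝ id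

theorem barycentre_mem_convexHull {k : ℕ} (e : O.Simplex k) :
    O.barycentre e ∈ convexHull ℝ (e.1 : Set (Space q)) := by
  have := e.1.centroid_mem_convexHull (Simplex.nonempty O e) (R := ℝ)
  exact this

/-- An affine function vanishing at the barycentre is linear along each ray from it, so the side
keeps its sign along the ray. -/
theorem side_lineMap_barycentre (e : O.Edge) (w : Space q) (t : ℝ) :
    O.side e (AffineMap.lineMap (O.barycentre e) w t) = t * O.side e w := by
  have h0 := O.side_eq_zero_of_mem_convexHull e (O.barycentre_mem_convexHull e)
  obtain ⟨φ, hφ⟩ := O.exists_affineMap_side e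
  rw [← hφ, φ.apply_lineMap, hφ, hφ, h0]
  simp [AffineMap.lineMap_apply]

/-- The `q + 1` vertices of `e` cannot affinely span a space of dimension `q + 1`; a point off their
span completes them to an affinely independent family. -/
theorem exists_side_ne_zero (e : O.Edge) : ∃ w, O.side e w ≠ 0 := by
  let := O.vord
  let f : Fin (q + 1) → Space q := fun i => Finset.orderEmbOfFin e.1 e.2.2 i
  have hfi : AffineIndependent ℝ f := by
    have := (O.K.indep e.2.1).comp_embedding
      ⟨fun i => (⟨f i, Finset.orderEmbOfFin_mem _ _ i⟩ : e.1), fun i j h =>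
        (Finset.orderEmbOfFin e.1 e.2.2).injective (congrArg Subtype.val h)⟩
    exact this
  have htop : affineSpan ℝ (Set.range f) ≠ ⊤ := by
    rw [Ne, hfi.affineSpan_eq_top_iff_card_eq_finrank_add_one]
    simp
  obtain ⟨w, hw⟩ : ∃ w, w ∉ affineSpan ℝ (Set.range f) := by
    by_contra! h
    exact htop (top_unique fun x _ => h x)
  refine ⟨w, mul_ne_zero (by simp) (orientDet_ne_zero ?_)⟩
  refine AffineIndependent.affineIndependent_of_notMem_span (i := 0) ?_ ?_
  · refine (affineIndependent_equiv (finSuccAboveEquiv (0 : Fin (q + 2)))).1 ?_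
    have heq : (fun x : {y : Fin (q + 2) // y ≠ 0} => (Fin.cons w f : Fin (q + 2) → Space q) x) ∘
        finSuccAboveEquiv (0 : Fin (q + 2)) = f := by
      funext j
      simp [finSuccAboveEquiv_apply]
    exact heq ▸ hfi
  · have himg : (Fin.cons w f : Fin (q + 2) → Space q) '' {x | x ≠ 0} = Set.range f := by
      ext y
      constructor
      · rintro ⟨x, hx, rfl⟩
        obtain ⟨j, rfl⟩ := Fin.exists_succ_eq.2 hx
        exact ⟨j, by simp⟩
      · rintro ⟨j, rfl⟩
        exact ⟨j.succ, Fin.succ_ne_zero j, by simp⟩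
    erw [himg]
    exact hw

theorem exists_side_pos (ε : ℤˣ) (e : O.Edge) : ∃ w, 0 < ((ε : ℤ) : ℝ) * O.side e w := by
  obtain ⟨w, hw⟩ := O.exists_side_ne_zero e
  have hw' : ((ε : ℤ) : ℝ) * O.side e w ≠ 0 := mul_ne_zero (by simp) hw
  rcases lt_or_gt_of_ne hw' with h | h
  · refine ⟨AffineMap.lineMap (O.barycentre e) w (-1 : ℝ), ?_⟩
    rw [O.side_lineMap_barycentre]
    linarith
  · exact ⟨w, h⟩

/-! ### Facets and voids on either side of an edge. -/

variable {O}

/-- The apex of a facet-simplex with incidence number `ε` lies on the side `ε`. -/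
theorem side_apex_pos {τ : O.Facet} {e : O.Edge} {ε : ℤˣ} (h : O.incidence τ e = (ε : ℤ))
    {w : Space q} (hw : w ∈ τ.1) (hwe : w ∉ e.1) : 0 < ((ε : ℤ) : ℝ) * O.side e w := by
  obtain ⟨D, hD, hs⟩ := side_apex (subset_of_incidence_ne_zero (by rw [h]; simp)) hw hwe
  rw [hs, h, ← mul_assoc, ← Int.cast_mul, Int.units_coe_mul_self, Int.cast_one, one_mul]
  exact hD

theorem incidence_eq_of_side_apex_pos {τ : O.Facet} {e : O.Edge} {ε : ℤˣ} (h : e.1 ⊆ τ.1)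
    {w : Space q} (hw : w ∈ τ.1) (hwe : w ∉ e.1) (hs : 0 < ((ε : ℤ) : ℝ) * O.side e w) :
    O.incidence τ e = (ε : ℤ) := by
  obtain ⟨δ, hδ⟩ := incidence_eq_unit h
  have hp := side_apex_pos hδ hw hwe
  rw [hδ]
  rcases Int.units_eq_one_or δ with rfl | rfl <;> rcases Int.units_eq_one_or ε with rfl | rfl <;>
    first | rfl | (exfalso; push_cast at hp hs; linarith)

/-- Near its barycentre, the side `ε` of an edge-simplex is filled by any facet-simplex with
incidence number `ε`. -/
theorem eventually_mem_convexHull_facet {τ : O.Facet} {e : O.Edge} {ε : ℤˣ}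
    (h : O.incidence τ e = (ε : ℤ)) {w : Space q} (hw : 0 < ((ε : ℤ) : ℝ) * O.side e w) :
    ∀ᶠ t in 𝓝[>] (0 : ℝ), AffineMap.lineMap (O.barycentre e) w t ∈
      convexHull ℝ (τ.1 : Set (Space q)) := by
  classical
  have hsub : e.1 ⊆ τ.1 := subset_of_incidence_ne_zero (by rw [h]; simp)
  obtain ⟨a, haτ, hae, hall⟩ := exists_apex hsub
  have ha := side_apex_pos h haτ hae
  have hind := O.K.indep τ.2.1
  -- Membership in the facet becomes nonnegativity of finitely many barycentric coordinates, checked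
  -- one by one.
  let b : AffineBasis τ.1 ℝ (Space q) := ⟨_, hind, by
    rw [hind.affineSpan_eq_top_iff_card_eq_finrank_add_one]
    simp [τ.2.2]⟩
  have hb : ∀ i, b i = i.1 := fun i => rfl
  have hrange : Set.range b = (τ.1 : Set (Space q)) := by
    ext x; simp [hb]
  rw [← hrange, b.convexHull_eq_nonneg_coord]
  simp only [Set.mem_ofPred_eq]
  rw [eventually_all]
  rintro ⟨y, hy⟩
  rcases hall y hy with rfl | hye
  · filter_upwards [self_mem_nhdsWithin] with t ht
    set x := AffineMap.lineMap (O.barycentre e) w t with hx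
    -- The side vanishes at all vertices of `τ` but the apex, so it determines the sign of the apex
    -- coordinate.
    have hside : O.side e x = b.coord ⟨y, hy⟩ x * O.side e y := by
      conv_lhs => rw [← b.linear_combination_coord_eq_self x]
      rw [O.side_sum e _ _ _ (b.sum_coord_apply_eq_one x)]
      refine Finset.sum_eq_single_of_mem (⟨y, hy⟩ : {v // v ∈ τ.1}) (Finset.mem_univ _) ?_
      rintro ⟨v, hv⟩ - hne
      rcases hall v hv with rfl | hve
      · exact absurd rfl hne
      · exact mul_eq_zero_of_right _ (O.side_eq_zero_of_mem e hve)
    rw [O.side_lineMap_barycentre] at hside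
    have h1 : 0 < b.coord ⟨y, hy⟩ x * (((ε : ℤ) : ℝ) * O.side e y) := by
      calc 0 < t * (((ε : ℤ) : ℝ) * O.side e w) := mul_pos ht hw
        _ = _ := by linear_combination ((ε : ℤ) : ℝ) * hside
    exact (pos_of_mul_pos_left h1 ha.le).le
  -- Coordinates at vertices of `e` are positive at the barycentre, hence nearby by continuity.
  · have hpos : 0 < b.coord ⟨y, hy⟩ (O.barycentre e) := by
      have hc : (0 : ℝ) < (e.1.card : ℝ)⁻¹ :=
        inv_pos.2 (by exact_mod_cast (Simplex.nonempty O e).card_pos)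
      rw [barycentre, centroid_eq_sum _ (Simplex.nonempty O e), affineMap_sum _ _ _ _
        (by rw [Finset.sum_const, nsmul_eq_mul, mul_inv_cancel₀ (inv_pos.1 hc).ne'])]
      refine Finset.sum_pos' (fun v hv => mul_nonneg hc.le ?_) ⟨y, hye, mul_pos hc ?_⟩
      · have hv' : b.coord ⟨y, hy⟩ v = _ := b.coord_apply ⟨y, hy⟩ ⟨v, hsub hv⟩
        rw [hv']
        split_ifs <;> simp
      · exact one_pos.trans_eq (b.coord_apply_eq ⟨y, hy⟩).symm
    have hcont : Continuous fun t : ℝ =>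
        b.coord ⟨y, hy⟩ (AffineMap.lineMap (O.barycentre e) w t) := by
      simp only [AffineMap.apply_lineMap]
      exact AffineMap.lineMap_continuous
    have := hcont.tendsto 0
    simp only [AffineMap.lineMap_apply_zero] at this
    exact nhdsWithin_le_nhds ((this.eventually (lt_mem_nhds hpos)).mono fun _ ht => ht.le)

/-- Both facets would contain points near the barycentre strictly on side `ε`. But distinct facets
through `e` share no vertex outside `e`, so they meet inside the hull of `e`, where the side is
zero. -/
theorem facet_unique {τ τ' : O.Facet} {e : O.Edge} {ε : ℤˣ} (h : O.incidence τ e = (ε : ℤ))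
    (h' : O.incidence τ' e = (ε : ℤ)) : τ = τ' := by
  classical
  by_contra hne
  have hsub : e.1 ⊆ τ.1 := subset_of_incidence_ne_zero (by rw [h]; simp)
  have hsub' : e.1 ⊆ τ'.1 := subset_of_incidence_ne_zero (by rw [h']; simp)
  obtain ⟨a, haτ, hae, hall⟩ := exists_apex hsub
  have haτ' : a ∉ τ'.1 := fun haτ' => hne <| Subtype.ext <|
    Finset.eq_of_subset_of_card_le (fun v hv => by
      rcases hall v hv with rfl | hv
      · exact haτ'
      · exact hsub' hv) (by rw [τ.2.2, τ'.2.2])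
  have hinter : (τ.1 ∩ τ'.1 : Set (Space q)) ⊆ e.1 := fun v hv => by
    rcases hall v hv.1 with rfl | hve
    · exact absurd hv.2 haτ'
    · exact hve
  have ha := side_apex_pos h haτ hae
  obtain ⟨t, ht, ht', ht0⟩ := ((eventually_mem_convexHull_facet h ha).and
    ((eventually_mem_convexHull_facet h' ha).and self_mem_nhdsWithin)).exists
  have hz := O.side_eq_zero_of_mem_convexHull e (convexHull_mono hinter
    (O.K.inter_subset_convexHull τ.2.1 τ'.2.1 ⟨ht, ht'⟩))
  rw [O.side_lineMap_barycentre] at hz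
  rcases mul_eq_zero.1 hz with hz | hz
  · exact (ne_of_gt ht0) hz
  · rw [hz, mul_zero] at ha
    exact lt_irrefl _ ha

theorem not_voidTouches {τ : O.Facet} {e : O.Edge} {ε : ℤˣ} (h : O.incidence τ e = (ε : ℤ))
    (ν : O.Void) : ¬ O.VoidTouches ε e ν := by
  obtain ⟨C, x, -, rfl⟩ := ν
  rintro ⟨w, hw, hseg⟩
  obtain ⟨t, ht, ht0, ht1⟩ := ((eventually_mem_convexHull_facet h hw).and
    (Ioo_mem_nhdsGT (zero_lt_one (α := ℝ)))).exists
  have hmem : AffineMap.lineMap (O.barycentre e) w t ∈ openSegment ℝ (O.barycentre e) w := by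
    rw [openSegment_eq_image_lineMap]
    exact ⟨t, ⟨ht0, ht1⟩, rfl⟩
  exact connectedComponentIn_subset _ _ (hseg hmem) (O.K.convexHull_subset_space τ.2.1 ht)

/-- There are finitely many faces, so each is avoided separately. A face containing `e` with points
on side `ε` would be a facet of incidence `ε`; a face not containing `e` has a closed hull that
misses the barycentre. -/
theorem eventually_notMem_space {e : O.Edge} {ε : ℤˣ}
    (h : ∀ τ : O.Facet, O.incidence τ e ≠ (ε : ℤ)) {w : Space q}
    (hw : 0 < ((ε : ℤ) : ℝ) * O.side e w) :
    ∀ᶠ t in 𝓝[>] (0 : ℝ), AffineMap.lineMap (O.barycentre e) w t ∉ O.K.space := by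
  classical
  have hall : ∀ᶠ t in 𝓝[>] (0 : ℝ), ∀ s ∈ O.K.faces,
      AffineMap.lineMap (O.barycentre e) w t ∉ convexHull ℝ (s : Set (Space q)) := by
    rw [eventually_all_finite O.finite_faces]
    intro s hs
    by_cases hes : e.1 ⊆ s
    · filter_upwards [self_mem_nhdsWithin] with t ht0 ht
      have hpos : 0 < ((ε : ℤ) : ℝ) *
          O.side e (AffineMap.lineMap (O.barycentre e) w t) := by
        rw [O.side_lineMap_barycentre, mul_left_comm]
        exact mul_pos ht0 hw
      obtain ⟨m, hm0, hm1, hm⟩ := Finset.mem_convexHull'.1 ht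
      rw [← hm, O.side_sum e _ _ _ hm1, Finset.mul_sum] at hpos
      obtain ⟨a, has, ha⟩ := Finset.exists_lt_of_sum_lt
        (s := s) (f := fun _ => (0 : ℝ)) (by simpa using hpos)
      have hae : a ∉ e.1 := fun hae => by
        rw [O.side_eq_zero_of_mem e hae] at ha
        simp at ha
      -- At most `q + 2` vertices by dimension, and more than `q + 1` because `s` has the vertex `a`
      -- outside `e`.
      have hcard : s.card = q + 1 + 1 := by
        refine le_antisymm ?_ ?_
        · have := (O.K.indep hs).card_le_finrank_succ
          simp only [Fintype.card_coe] at this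
          refine this.trans (Nat.succ_le_succ ?_)
          refine (Submodule.finrank_le _).trans ?_
          simp
        · rw [← e.2.2]
          exact Finset.card_lt_card ⟨hes, fun hse => hae (hse has)⟩
      refine h ⟨s, hs, hcard⟩ (incidence_eq_of_side_apex_pos hes has hae ?_)
      rw [mul_left_comm] at ha
      exact pos_of_mul_pos_right ha (hm0 a has)
    · have hb : O.barycentre e ∉ convexHull ℝ (s : Set (Space q)) := fun hb => by
        have hmem := O.K.inter_subset_convexHull e.2.1 hs ⟨O.barycentre_mem_convexHull e, hb⟩
        rw [← Finset.coe_inter] at hmem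
        exact centroid_notMem_convexHull (O.K.indep e.2.1) (Simplex.nonempty O e)
          ⟨Finset.inter_subset_left, fun hsub =>
            hes (hsub.trans Finset.inter_subset_right)⟩ hmem
      have hclosed : IsClosed (convexHull ℝ (s : Set (Space q))) :=
        (s.finite_toSet.isCompact_convexHull ℝ).isClosed
      have hcont : Continuous fun t : ℝ => (AffineMap.lineMap (O.barycentre e) w t : Space q) :=
        AffineMap.lineMap_continuous
      have := hcont.tendsto 0
      simp only [AffineMap.lineMap_apply_zero] at this
      exact nhdsWithin_le_nhds (this.eventually (hclosed.isOpen_compl.mem_nhds hb))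
  filter_upwards [hall] with t ht hmem
  obtain ⟨s, hs, hts⟩ := O.K.mem_space_iff.1 hmem
  exact ht s hs hts

theorem exists_voidTouches {e : O.Edge} {ε : ℤˣ}
    (h : ∀ τ : O.Facet, O.incidence τ e ≠ (ε : ℤ)) : ∃ ν, O.VoidTouches ε e ν := by
  obtain ⟨w, hw⟩ := O.exists_side_pos ε e
  obtain ⟨r, hr0, hr⟩ := mem_nhdsGT_iff_exists_Ioo_subset.1 (eventually_notMem_space h hw)
  -- Cutting the segment at parameter `r` makes it avoid `|K|`; being convex, it then lies in one
  -- component.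
  have hr0 : 0 < r := hr0
  set w' := AffineMap.lineMap (O.barycentre e) w r with hw'
  have hseg : openSegment ℝ (O.barycentre e) w' ⊆ (O.K.space)ᶜ := by
    rw [openSegment_eq_image_lineMap]
    rintro _ ⟨t, ⟨ht0, ht1⟩, rfl⟩
    have : AffineMap.lineMap (O.barycentre e) w' t =
        AffineMap.lineMap (O.barycentre e) w (t * r) := by
      simp [hw', AffineMap.lineMap_apply, mul_smul]
    rw [this]
    exact hr ⟨mul_pos ht0 hr0, by nlinarith⟩
  have hx : AffineMap.lineMap (O.barycentre e) w' (1 / 2 : ℝ) ∈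
      openSegment ℝ (O.barycentre e) w' := by
    rw [openSegment_eq_image_lineMap]
    exact ⟨1 / 2, by norm_num, rfl⟩
  refine ⟨⟨_, _, hseg hx, rfl⟩, w', ?_, ?_⟩
  · rw [hw', O.side_lineMap_barycentre, mul_left_comm]
    exact mul_pos hr0 hw
  · exact (convex_openSegment _ _).isPreconnected.subset_connectedComponentIn hx hseg

theorem exists_isCoface (ε : ℤˣ) (e : O.Edge) : ∃ c, O.IsCoface ε e c := by
  by_cases h : ∃ τ : O.Facet, O.incidence τ e = (ε : ℤ)
  · obtain ⟨τ, hτ⟩ := h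
    exact ⟨Sum.inl τ, hτ⟩
  · obtain ⟨ν, hν⟩ := exists_voidTouches (not_exists.1 h)
    exact ⟨Sum.inr ν, hν⟩

/-- The constraints range over darts, so an edge without one would leave its variables unrelated to
`z` and `π`. -/
theorem exists_dart (e : O.Edge) : ∃ η τ, O.Dart e η τ := by
  obtain ⟨η, hη⟩ := exists_isCoface (-1) e
  obtain ⟨τ, hτ⟩ := exists_isCoface 1 e
  exact ⟨η, τ, hη, hτ⟩

/-! ### The linear program and the flat norm. -/

section LP

variable {R : Type*} [CommRing R]

-- Several voids might touch `e` from one side, but this is harmless because `p` vanishes on all of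
-- them.
open Classical in
theorem sum_facets_eq_of_isCoface {ε : ℤˣ} {e : O.Edge} {c : O.Cell} (h : O.IsCoface ε e c)
    (p : O.Cell → R) (hp : ∀ ν, p (Sum.inr ν) = 0) :
    ∑ τ : O.Facet, (if O.incidence τ e = (ε : ℤ) then p (Sum.inl τ) else 0) = p c := by
  rcases c with τ | ν
  · have h : O.incidence τ e = (ε : ℤ) := h
    rw [Finset.sum_eq_single τ _ (by simp), if_pos h]
    exact fun τ' _ hne => if_neg fun h' => hne (facet_unique h' h)
  · rw [hp]
    exact Finset.sum_eq_zero fun τ _ => if_neg fun h' => not_voidTouches h' ν h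

/-- The boundary of a chain at `e = (η ⇀ τ)` is the difference of its values at `τ` and `η`. -/
theorem boundary_eq_of_dart {e : O.Edge} {η τ : O.Cell} (h : O.Dart e η τ)
    (p : O.Cell → R) (hp : ∀ ν, p (Sum.inr ν) = 0) :
    O.boundary q (fun τ => p (Sum.inl τ)) e = p τ - p η := by
  classical
  -- The boundary sum splits into the facets of incidence `1` minus those of incidence `-1`.
  rw [← sum_facets_eq_of_isCoface h.1 p hp, ← sum_facets_eq_of_isCoface h.2 p hp,
    ← Finset.sum_sub_distrib]
  refine Finset.sum_congr rfl fun s _ => ?_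
  by_cases hs : e.1 ⊆ s.1
  · obtain ⟨δ, hδ⟩ := incidence_eq_unit hs
    rcases Int.units_eq_one_or δ with rfl | rfl <;> simp [hδ]
  · have : O.incidence s e = 0 := if_neg hs
    simp [this]

variable [LinearOrder R] [IsStrictOrderedRing R]

/-- Given the void constraints, the inequality constraints bound `x⃗` by `z - ∂π`. -/
theorem DirVar.Feasible.le_xOpp {v : O.DirVar R} {d : O.DirData R} (hv : v.Feasible d)
    (e : O.Edge) : d.z e - O.boundary q v.chain e ≤ v.xOpp e := by
  obtain ⟨η, τ, h⟩ := exists_dart e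
  have hb := boundary_eq_of_dart h v.pot hv.void
  change O.boundary q v.chain e = _ at hb
  rw [hb]
  linarith [hv.opp e η τ h]

theorem DirVar.Feasible.le_xNat {v : O.DirVar R} {d : O.DirData R} (hv : v.Feasible d)
    (e : O.Edge) : -(d.z e - O.boundary q v.chain e) ≤ v.xNat e := by
  obtain ⟨η, τ, h⟩ := exists_dart e
  have hb := boundary_eq_of_dart h v.pot hv.void
  change O.boundary q v.chain e = _ at hb
  rw [hb]
  linarith [hv.nat e η τ h]

/-- The feasible solution given by a `(q+1)`-chain `p` and the `q`-chain `z - ∂p`. -/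
noncomputable def DirVar.ofChain (d : O.DirData R) (p : O.Chain R (q + 1)) : O.DirVar R where
  pot := Sum.elim p 0
  potPos := fun τ => max (p τ) 0
  potNeg := fun τ => max (-p τ) 0
  xNat := fun e => max (-(d.z e - O.boundary q p e)) 0
  xOpp := fun e => max (d.z e - O.boundary q p e) 0

theorem max_zero_sub_max_neg_zero (a : R) : max a 0 - max (-a) 0 = a := by
  rcases le_total 0 a with h | h <;> simp [h]

theorem max_zero_add_max_neg_zero (a : R) : max a 0 + max (-a) 0 = |a| := by
  rcases le_total 0 a with h | h <;> simp [h, abs_of_nonneg, abs_of_nonpos]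

theorem DirVar.ofChain_feasible (d : O.DirData R) (p : O.Chain R (q + 1)) :
    (DirVar.ofChain d p).Feasible d where
  nat e η τ h := by
    have hb := boundary_eq_of_dart h (DirVar.ofChain d p).pot fun _ => rfl
    change O.boundary q p e = _ at hb
    have := le_max_left (-(d.z e - O.boundary q p e)) 0
    change _ + max (-(d.z e - O.boundary q p e)) 0 ≥ _
    linarith
  opp e η τ h := by
    have hb := boundary_eq_of_dart h (DirVar.ofChain d p).pot fun _ => rfl
    change O.boundary q p e = _ at hb
    have := le_max_left (d.z e - O.boundary q p e) 0
    change _ + max (d.z e - O.boundary q p e) 0 ≥ _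
    linarith
  xNat_nonneg _ := le_max_right _ _
  xOpp_nonneg _ := le_max_right _ _
  void _ := rfl
  potPos_nonneg _ := le_max_right _ _
  potNeg_nonneg _ := le_max_right _ _
  pot_eq τ := (max_zero_sub_max_neg_zero (p τ)).symm

omit [IsStrictOrderedRing R] in
theorem DirVar.Feasible.cost_eq {v : O.DirVar R} {d : O.DirData R} (hv : v.Feasible d) :
    v.cost d = ∑ τ, d.a τ * (v.potPos τ + v.potNeg τ) + ∑ e, d.c e * (v.xNat e + v.xOpp e) := by
  simp [DirVar.cost, hv.void, mul_add, Finset.sum_add_distrib]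

theorem DirVar.cost_ofChain (d : O.DirData R) (p : O.Chain R (q + 1)) :
    (DirVar.ofChain d p).cost d = weight d.a p + weight d.c (d.z - O.boundary q p) := by
  rw [(DirVar.ofChain_feasible d p).cost_eq]
  simp only [DirVar.ofChain, weight, max_zero_add_max_neg_zero]
  simp only [add_comm (max (-(_ : R)) 0), max_zero_add_max_neg_zero, Pi.sub_apply]

/-- With the potentials fixed, the cheapest edge variables are the positive and negative parts of `z
- ∂π`. As `c` is strictly positive, any excess over them would contradict optimality. -/
theorem DirVar.Optimal.x_eq {v : O.DirVar R} {d : O.DirData R} (hc : ∀ e, 0 < d.c e)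
    (hv : v.Optimal d) : v.x = d.z - O.boundary q v.chain := by
  -- Keeping `potPos` and `potNeg` makes the area terms of the two costs cancel.
  let w : O.DirVar R := { DirVar.ofChain d v.chain with
    pot := v.pot
    potPos := v.potPos
    potNeg := v.potNeg }
  have hf := hv.1
  have hw : w.Feasible d :=
    { nat := fun e η τ h => by
        have hb := boundary_eq_of_dart h v.pot hf.void
        change O.boundary q v.chain e = _ at hb
        have := le_max_left (-(d.z e - O.boundary q v.chain e)) 0
        change v.pot η - v.pot τ + max (-(d.z e - O.boundary q v.chain e)) 0 ≥ _
        linarith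
      opp := fun e η τ h => by
        have hb := boundary_eq_of_dart h v.pot hf.void
        change O.boundary q v.chain e = _ at hb
        have := le_max_left (d.z e - O.boundary q v.chain e) 0
        change v.pot τ - v.pot η + max (d.z e - O.boundary q v.chain e) 0 ≥ _
        linarith
      xNat_nonneg := fun _ => le_max_right _ _
      xOpp_nonneg := fun _ => le_max_right _ _
      void := hf.void
      potPos_nonneg := hf.potPos_nonneg
      potNeg_nonneg := hf.potNeg_nonneg
      pot_eq := hf.pot_eq }
  have hle := hv.2 w hw
  rw [hf.cost_eq, hw.cost_eq] at hle
  have hN : ∀ e, w.xNat e ≤ v.xNat e := fun e => max_le (hf.le_xNat e) (hf.xNat_nonneg e)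
  have hO : ∀ e, w.xOpp e ≤ v.xOpp e := fun e => max_le (hf.le_xOpp e) (hf.xOpp_nonneg e)
  have hmono : ∀ e ∈ Finset.univ, d.c e * (w.xNat e + w.xOpp e) ≤
      d.c e * (v.xNat e + v.xOpp e) := fun e _ =>
    mul_le_mul_of_nonneg_left (add_le_add (hN e) (hO e)) (hc e).le
  -- Equal sums of termwise comparable families agree term by term.
  have heq := (Finset.sum_eq_sum_iff_of_le hmono).1
    (le_antisymm (Finset.sum_le_sum hmono) (le_of_add_le_add_left hle))
  funext e
  have he := le_of_mul_le_mul_left (heq e (Finset.mem_univ e)).ge (hc e)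
  have h1 : v.xNat e = w.xNat e := by linarith [hN e, hO e]
  have h2 : v.xOpp e = w.xOpp e := by linarith [hN e, hO e]
  rw [DirVar.x, h1, h2]
  exact max_zero_sub_max_neg_zero (d.z e - O.boundary q v.chain e)

/-- An inequality suffices for the comparison. It avoids identifying `potPos` and `potNeg` with the
parts of `π`, which can fail where `a` is zero. -/
theorem DirVar.Optimal.weight_le_cost {v : O.DirVar R} {d : O.DirData R} (hc : ∀ e, 0 < d.c e)
    (ha : ∀ τ, 0 ≤ d.a τ) (hv : v.Optimal d) :
    weight d.c v.x + weight d.a v.chain ≤ v.cost d := by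
  rw [hv.1.cost_eq, add_comm]
  refine add_le_add (Finset.sum_le_sum fun τ _ => mul_le_mul_of_nonneg_left ?_ (ha τ))
    (Finset.sum_le_sum fun e _ => mul_le_mul_of_nonneg_left ?_ (hc e).le)
  · rw [DirVar.chain, hv.1.pot_eq]
    have := hv.1.potPos_nonneg τ
    have := hv.1.potNeg_nonneg τ
    exact abs_le.2 ⟨by linarith, by linarith⟩
  · rw [DirVar.x]
    have := hv.1.xNat_nonneg e
    have := hv.1.xOpp_nonneg e
    exact abs_le.2 ⟨by linarith, by linarith⟩

theorem DirVar.Optimal.isMinimalCycle {v : O.DirVar R} {d : O.DirData R} (hc : ∀ e, 0 < d.c e)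
    (ha : ∀ τ, 0 ≤ d.a τ) (hz : O.IsCycle q d.z) (hv : v.Optimal d) :
    IsMinimalCycle d v.x v.chain := by
  have hx := hv.x_eq hc
  have hb : O.boundary q v.chain = d.z - v.x := by rw [hx, sub_sub_cancel]
  refine ⟨hx ▸ IsCycle.sub O hz (O.isCycle_boundary _), ⟨_, hb⟩, hb, fun x' p' _ hb' => ?_⟩
  have hle := hv.2 _ (DirVar.ofChain_feasible d p')
  -- Since `z - ∂p' = x'`, the feasible point built from `p'` costs exactly the flat norm cost of
  -- `(x', p')`.
  rw [DirVar.cost_ofChain, hb', sub_sub_cancel, add_comm] at hle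
  exact (hv.weight_le_cost hc ha).trans hle

end LP

end OrientedComplex

end FlatNorm

theorem mainTheorem9 {R : Type*} [CommRing R] [LinearOrder R] [IsStrictOrderedRing R]
    {q : ℕ} (O : FlatNorm.OrientedComplex q) (d : O.DirData R)
    (hc : ∀ e, 0 < d.c e) (ha : ∀ τ, 0 ≤ d.a τ) (hz : O.IsCycle q d.z)
    (v : O.DirVar R) (hv : v.Optimal d) :
    (∀ ν, v.pot (Sum.inr ν) = 0) ∧
    FlatNorm.OrientedComplex.IsMinimalCycle d v.x v.chain ∧
    ((∀ τ, d.a τ = 0) → ∀ x' : O.Chain R q, O.IsCycle q x' → O.Homologous d.z x' →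
      FlatNorm.OrientedComplex.weight d.c v.x ≤ FlatNorm.OrientedComplex.weight d.c x') := by
  have hmin := hv.isMinimalCycle hc ha hz
  refine ⟨hv.1.void, hmin, fun ha0 x' hx' ⟨p', hp'⟩ => ?_⟩
  simpa [FlatNorm.OrientedComplex.weight, ha0] using hmin.2.2.2 x' p' hx' hp'
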